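/- **Definitions.** Let $k\ge 0$ and $s\ge 1$ be integers. Formal commutators in letters $u_1,\dots,u_k$ are the letters themselves and the expressions $[a,b]$ with $a,b$ formal commutators; the weight vector $\chi\in\mathbb{N}_0^k$ is given by $\chi(u_i)=e_i$, $\chi([a,b])=\chi(a)+\chi(b)$, and the order of a commutator is the number of letters in it. An *ordered list of basic commutators of order at most $s$* is a list $c_1\prec\dots\prec c_t$ of distinct formal commutators which starts with $c_i=u_i$ for $1\le i\le k$, in which orders are non-decreasing, and whose other members are exactly the $[a,b]$ of order at most $s$ such that $a,b$ are in the list, $a\succ b$, and, if $a=[a_1,a_2]$, then $b\succeq a_2$. (Commutators of the same order may be listed in any order.) In a group, commutators are evaluated by $[x,y]=x^{-1}y^{-1}xy$. Fix such a list. A subset $A$ of a group $G$ is an *$s$-step nilpotent progression on $k$ generators with side lengths $L=(L_1,\dots,L_k)$* (positive integers) if there are $u_1,\dots,u_k\in G$ generating a subgroup that is nilpotent of class at most $s$, such that $$A=\{u_1^{l_1}\cdots u_t^{l_t} : l_j\in\mathbb{Z},\ |l_j|\le L^{\chi(j)}\},$$ where $u_j$ is the value of $c_j$ at $u_1,\dots,u_k$,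 $\chi(j)$ is the weight vector of $c_j$, and $L^{\chi}=L_1^{\chi_1}\cdots L_k^{\chi_k}$. A map $\phi:A\to B$ between subsets of groups is a *Freĭman $3$-homomorphism* if for all $a_1,a_2,a_3\in A$ and $\varepsilon_1,\varepsilon_2,\varepsilon_3\in\{-1,0,1\}$, $a_1^{\varepsilon_1}a_2^{\varepsilon_2}a_3^{\varepsilon_3}=1$ implies $\phi(a_1)^{\varepsilon_1}\phi(a_2)^{\varepsilon_2}\phi(a_3)^{\varepsilon_3}=1$. **Proposition A.1 (Invariance under Freĭman isomorphism).** For all integers $k\ge 0$ and $s\ge 1$ there is a constant $C_{k,s}\ge 1$, depending only on $k$ and $s$, such that the following holds for every ordered list of basic commutators of order at most $s$ in $k$ letters. Let $G$ and $H$ be groups, let $A\subseteq G$ be an $s$-step nilpotent progression on $k$ generators with side lengths $L_1,\dots,L_k$ satisfying $L_i\ge C_{k,s}$ for all $i$, and let $\phi$ be a Freĭman $3$-homomorphism from $A$ onto a set $B\subseteq H$. Then $B$ is an $s$-step nilpotent progression on $k$ generators (with some side lengths, and with respect to the same list). -/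

import Mathlib

/-- Formal (unevaluated) iterated commutators in `k` letters. -/
inductive FormalCommutator (k : ℕ) : Type
  | gen (i : Fin k) : FormalCommutator k
  | comm (a b : FormalCommutator k) : FormalCommutator k

namespace FormalCommutator

/-- The weight vector `χ(a) ∈ ℕ₀ᵏ`: `χ(uᵢ) = eᵢ` and `χ([a, b]) = χ(a) + χ(b)`. -/
def weight {k : ℕ} : FormalCommutator k → (Fin k → ℕ)
  | gen i => Pi.single i 1
  | comm a b => weight a + weight b

/-- The order of a formal commutator: the number of letters in it. -/
def order {k : ℕ} : FormalCommutator k → ℕ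
  | gen _ => 1
  | comm a b => order a + order b

/-- The value of a formal commutator at group elements `u₁, …, u_k`, with the convention
`[x, y] = x⁻¹ y⁻¹ x y`. -/
def eval {G : Type*} [Group G] {k : ℕ} (u : Fin k → G) : FormalCommutator k → G
  | gen i => u i
  | comm a b => (eval u a)⁻¹ * (eval u b)⁻¹ * eval u a * eval u b

end FormalCommutator

/-- `c` is an ordered list `c₁ ≺ ⋯ ≺ c_t` of the basic commutators of order at most `s` in `k`
letters (in the sense of M. Hall): without repetitions, starting with the `k` letters in their
given order, lower orders before higher ones, and containing, besides the letters, exactly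
those `[a, b]` of order at most `s` such that `a` and `b` are in the list, `b ≺ a`, and
`a₂ ≼ b` in case `a = [a₁, a₂]`. Commutators of equal order may come in any order. -/
structure IsBasicCommutatorList (k s : ℕ) {t : ℕ} (c : Fin t → FormalCommutator k) : Prop where
  injective : Function.Injective c
  letters_first : ∀ i : Fin k, ∃ h : i.val < t, c ⟨i.val, h⟩ = FormalCommutator.gen i
  order_mono : ∀ i j : Fin t, i ≤ j → (c i).order ≤ (c j).order
  mem_iff : ∀ a b : FormalCommutator k,
    FormalCommutator.comm a b ∈ Set.range c ↔
      (FormalCommutator.comm a b).order ≤ s ∧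
        ∃ i j : Fin t, c i = a ∧ c j = b ∧ j < i ∧
          ∀ a₁ a₂ : FormalCommutator k, a = FormalCommutator.comm a₁ a₂ →
            ∃ m : Fin t, c m = a₂ ∧ m ≤ j

/-- The set `{u₁^{l₁} ⋯ u_t^{l_t} : |l_j| ≤ L^{χ(j)}}`, where `u_j` is the value of the `j`-th
member of the list `c` at `u₁, …, u_k`, and `L^χ = L₁^{χ₁} ⋯ L_k^{χ_k}`. -/
def nilpotentProgression {G : Type*} [Group G] {k t : ℕ} (c : Fin t → FormalCommutator k)
    (u : Fin k → G) (L : Fin k → ℕ) : Set G :=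
  {g | ∃ l : Fin t → ℤ,
    (∀ j, |l j| ≤ ((∏ i, L i ^ (c j).weight i : ℕ) : ℤ)) ∧
      g = (List.ofFn fun j => (c j).eval u ^ l j).prod}

/-- `A` is an `s`-step nilpotent progression in the group `G` on `k` generators with side lengths
`L` (positive integers), with respect to the ordered list `c` of basic commutators. The ambient
group need not be nilpotent: the generators have to lie in an `s`-step nilpotent subgroup, that
is, the subgroup they generate is nilpotent of class at most `s`. -/
def IsNilpotentProgression {G : Type*} [Group G] (s : ℕ) {k t : ℕ}
    (c : Fin t → FormalCommutator k) (L : Fin k → ℕ) (A : Set G) : Prop :=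
  (∀ i, 0 < L i) ∧ ∃ u : Fin k → G,
    Subgroup.lowerCentralSeries (Subgroup.closure (Set.range u)) s = ⊥ ∧
      A = nilpotentProgression c u L

/-- `φ`, restricted to `A`, is a Freiman `n`-homomorphism: for `a₁, …, aₙ ∈ A` and signs
`ε₁, …, εₙ ∈ {-1, 0, 1}`, if `a₁^{ε₁} ⋯ aₙ^{εₙ} = 1` then `φ(a₁)^{ε₁} ⋯ φ(aₙ)^{εₙ} = 1`.
Values of `φ` outside `A` play no role. -/
def IsFreimanHom {G H : Type*} [Group G] [Group H] (n : ℕ) (A : Set G) (φ : G → H) : Prop :=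
  ∀ (a : Fin n → G) (ε : Fin n → ℤ), (∀ i, a i ∈ A) →
    (∀ i, ε i = -1 ∨ ε i = 0 ∨ ε i = 1) →
    (List.ofFn fun i => a i ^ ε i).prod = 1 → (List.ofFn fun i => φ (a i) ^ ε i).prod = 1

/-! The image is the progression with the same side lengths on the generators φ(u_i). In the free
group, modulo the term of index `s` of the lower central series, the commutator of a basic
commutator c_j with a letter is an ordered product of basic commutators of larger order. The
exponents depend on the list alone (`exists_universal_exponents`), and there are finitely many
lists, so one constant C bounds them all.

If all sides are at least C and u_i precedes c_j, the right-hand side of c_j u_i = u_i c_j ∏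
c_m^{e_m} is an ordered product inside A, so φ preserves the relation (`IsFreimanHom.map_swap`). The
same argument for c_p c_q = c_q c_p [c_p, c_q] shows that φ commutes with evaluating basic
commutators (`IsFreimanHom.map_eval`). The transported relations alone force the φ(u_i) to generate
a group of class at most `s` (`lowerCentralSeries_closure_eq_bot`), although H is arbitrary. -/

open Subgroup
open scoped commutatorElement

/-! ### Commutators modulo a normal subgroup and the lower central series -/

section CommutatorCalculus

variable {G : Type*} [Group G]

theorem commutatorElement_mem_iff_commute (N : Subgroup G) [N.Normal] (x y : G) :
    ⁅x, y⁆ ∈ N ↔ Commute (x : G ⧸ N) (y : G ⧸ N) := by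
  rw [← commutatorElement_eq_one_iff_commute, ← QuotientGroup.eq_one_iff]
  rfl

/-- The subgroup of the elements that commute with `x` modulo the normal subgroup `N`. -/
def centralizerMod (N : Subgroup G) [N.Normal] (x : G) : Subgroup G :=
  (centralizer {(x : G ⧸ N)}).comap (QuotientGroup.mk' N)

theorem mem_centralizerMod {N : Subgroup G} [N.Normal] {x y : G} :
    y ∈ centralizerMod N x ↔ ⁅x, y⁆ ∈ N := by
  rw [commutatorElement_mem_iff_commute, centralizerMod, mem_comap, mem_centralizer_singleton_iff]
  exact ⟨fun h => h.symm, fun h => h.symm⟩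

theorem commutatorElement_mem_comm {N : Subgroup G} {x y : G} (h : ⁅x, y⁆ ∈ N) : ⁅y, x⁆ ∈ N := by
  rw [← commutatorElement_inv]
  exact N.inv_mem h

theorem commutatorElement_inv_inv_mem_iff {N : Subgroup G} [N.Normal] {x y : G} :
    ⁅x⁻¹, y⁻¹⁆ ∈ N ↔ ⁅x, y⁆ ∈ N := by
  simp only [commutatorElement_mem_iff_commute, QuotientGroup.mk_inv, Commute.inv_inv_iff]

/-- A form of the Jacobi identity for commutators that commute with each other. -/
theorem commute_commutatorElement_of_rotate {a b c : G}
    (h₁ : Commute ⁅a, b⁆ ⁅b, c⁆) (h₂ : Commute ⁅b, c⁆ ⁅c, a⁆) (h₃ : Commute ⁅c, a⁆ ⁅a, b⁆)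
    (ha : Commute ⁅b, c⁆ a) (hb : Commute ⁅c, a⁆ b) : Commute ⁅a, b⁆ c := by
  have e (x y : G) : x * y * x⁻¹ = ⁅x, y⁆ * y := by simp [commutatorElement_def]
  -- Hall–Witt identity: writing each conjugate as ⁅x, y⁆ * y makes two of its three factors
  -- trivial.
  have H := commutatorElement_commutatorElement_conj_mul a b c
  rw [e, e, e, (h₂.mul_right ha).commutator_eq, (h₃.mul_right hb).commutator_eq, mul_one, mul_one,
    commutatorElement_eq_one_iff_commute] at H
  have H' := h₁.inv_right.mul_right H
  rwa [inv_mul_cancel_left] at H'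

theorem commutatorElement_mem_of_rotate {N : Subgroup G} [N.Normal] {a b c : G}
    (h₁ : ⁅⁅a, b⁆, ⁅b, c⁆⁆ ∈ N) (h₂ : ⁅⁅b, c⁆, ⁅c, a⁆⁆ ∈ N) (h₃ : ⁅⁅c, a⁆, ⁅a, b⁆⁆ ∈ N)
    (ha : ⁅⁅b, c⁆, a⁆ ∈ N) (hb : ⁅⁅c, a⁆, b⁆ ∈ N) : ⁅⁅a, b⁆, c⁆ ∈ N := by
  rw [commutatorElement_mem_iff_commute] at *
  exact commute_commutatorElement_of_rotate (a := (a : G ⧸ N)) (b := (b : G ⧸ N))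
    (c := (c : G ⧸ N)) h₁ h₂ h₃ ha hb

/-- The three subgroups lemma, applied in the quotient by `N`. -/
theorem commutator_commutator_le_of_rotate {H₁ H₂ H₃ N : Subgroup G} [N.Normal]
    (h₁ : ⁅⁅H₂, H₃⁆, H₁⁆ ≤ N) (h₂ : ⁅⁅H₃, H₁⁆, H₂⁆ ≤ N) : ⁅⁅H₁, H₂⁆, H₃⁆ ≤ N := by
  have e (K : Subgroup G) : K ≤ N ↔ K.map (QuotientGroup.mk' N) = ⊥ := by
    rw [Subgroup.map_eq_bot_iff, QuotientGroup.ker_mk']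
  rw [e, map_commutator, map_commutator] at *
  exact commutator_commutator_eq_bot_of_rotate h₁ h₂

/-- Indices start at 0, so the term of index p is γ_{p+1} and this is [γ_a, γ_b] ≤ γ_{a+b}. It
follows from the three subgroups lemma by induction on `q`. -/
theorem commutator_lowerCentralSeries_le (p q : ℕ) :
    ⁅(⊤ : Subgroup G).lowerCentralSeries p, (⊤ : Subgroup G).lowerCentralSeries q⁆ ≤
      (⊤ : Subgroup G).lowerCentralSeries (p + q + 1) := by
  induction q generalizing p with
  | zero => exact le_rfl
  | succ q ih =>
    rw [commutator_comm, Subgroup.lowerCentralSeries_succ]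
    apply commutator_commutator_le_of_rotate
    · rw [commutator_comm ⊤, ← Subgroup.lowerCentralSeries_succ]
      exact (ih (p + 1)).trans (Subgroup.lowerCentralSeries_antitone _ (by omega))
    · exact commutator_mono (ih p) le_rfl

theorem commutatorElement_mem_lowerCentralSeries {p q n : ℕ} {x y : G}
    (hx : x ∈ (⊤ : Subgroup G).lowerCentralSeries p)
    (hy : y ∈ (⊤ : Subgroup G).lowerCentralSeries q) (hn : n ≤ p + q + 1) :
    ⁅x, y⁆ ∈ (⊤ : Subgroup G).lowerCentralSeries n :=
  Subgroup.lowerCentralSeries_antitone _ hn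
    (commutator_lowerCentralSeries_le p q (commutator_mem_commutator hx hy))

theorem normal_of_lowerCentralSeries_le {N : Subgroup G} {n : ℕ}
    (h₁ : (⊤ : Subgroup G).lowerCentralSeries (n + 1) ≤ N)
    (h₂ : N ≤ (⊤ : Subgroup G).lowerCentralSeries n) : N.Normal :=
  commutator_top_right_le_iff.1 ((commutator_mono h₂ le_rfl).trans h₁)

end CommutatorCalculus

/-! ### Formal commutators and basic commutator lists -/

namespace FormalCommutator

variable {G H : Type*} [Group G] [Group H] {k : ℕ}

theorem order_pos (a : FormalCommutator k) : 0 < a.order := by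
  induction a with
  | gen i => exact one_pos
  | comm a b ha hb => exact Nat.add_pos_left ha _

theorem exists_weight_pos (a : FormalCommutator k) : ∃ i, 0 < a.weight i := by
  induction a with
  | gen i => exact ⟨i, by simp [weight]⟩
  | comm a b ha hb =>
    obtain ⟨i, hi⟩ := ha
    exact ⟨i, Nat.add_pos_left hi _⟩

theorem eval_comm (u : Fin k → G) (a b : FormalCommutator k) :
    (comm a b).eval u = ⁅(a.eval u)⁻¹, (b.eval u)⁻¹⁆ := by
  simp [eval, commutatorElement_def]

theorem map_eval (f : G →* H) (u : Fin k → G) (a : FormalCommutator k) :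
    f (a.eval u) = a.eval (fun i => f (u i)) := by
  induction a with
  | gen i => rfl
  | comm a b ha hb => simp [eval, ha, hb]

theorem eval_mem_lowerCentralSeries (u : Fin k → G) (a : FormalCommutator k) :
    a.eval u ∈ (⊤ : Subgroup G).lowerCentralSeries (a.order - 1) := by
  induction a with
  | gen i => exact mem_top _
  | comm a b ha hb =>
    rw [eval_comm]
    refine commutatorElement_mem_lowerCentralSeries (inv_mem ha) (inv_mem hb) ?_
    have := a.order_pos
    have := b.order_pos
    simp only [order]
    omega

theorem finite_order_le (n : ℕ) : {a : FormalCommutator k | a.order ≤ n}.Finite := by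
  induction n with
  | zero =>
    convert Set.finite_empty
    ext a
    simp [a.order_pos.ne']
  | succ n ih =>
    refine ((Set.finite_range gen).union (ih.image2 comm ih)).subset ?_
    rintro (i | ⟨a, b⟩) h
    · exact Or.inl ⟨i, rfl⟩
    · refine Or.inr ⟨a, ?_, b, ?_, rfl⟩ <;>
      · have := a.order_pos
        have := b.order_pos
        simp only [Set.mem_ofPred_eq, order] at h ⊢
        omega

end FormalCommutator

namespace IsBasicCommutatorList

variable {k s t : ℕ} {c : Fin t → FormalCommutator k} {G : Type*} [Group G]

theorem order_le (hc : IsBasicCommutatorList k s c) (hs : 1 ≤ s) (j : Fin t) :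
    (c j).order ≤ s := by
  rcases h : c j with i | ⟨a, b⟩
  · exact hs
  · exact ((hc.mem_iff a b).1 ⟨j, h⟩).1

/-- The position of the `i`-th letter. -/
theorem exists_letter (hc : IsBasicCommutatorList k s c) (i : Fin k) :
    ∃ j : Fin t, j.val = i.val ∧ c j = FormalCommutator.gen i :=
  let ⟨h, e⟩ := hc.letters_first i
  ⟨⟨i, h⟩, rfl, e⟩

theorem lt_of_order_lt (hc : IsBasicCommutatorList k s c) {i j : Fin t}
    (h : (c i).order < (c j).order) : i < j :=
  lt_of_not_ge fun hij => absurd (hc.order_mono _ _ hij) h.not_ge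

end IsBasicCommutatorList

/-! ### Basic commutators span the lower central quotients -/

section BasicSpan

variable {k s t : ℕ} {c : Fin t → FormalCommutator k} {G : Type*} [Group G]

/-- The subgroup generated by the values of the members of `c` of order `n`, together with the
`(n + 1)`-st term of the lower central series. -/
def basicSpan (c : Fin t → FormalCommutator k) (u : Fin k → G) (n : ℕ) : Subgroup G :=
  closure {x | ∃ j, (c j).order = n ∧ (c j).eval u = x} ⊔ (⊤ : Subgroup G).lowerCentralSeries n

theorem eval_mem_basicSpan (c : Fin t → FormalCommutator k) (u : Fin k → G) (j : Fin t) :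
    (c j).eval u ∈ basicSpan c u (c j).order :=
  mem_sup_left (subset_closure ⟨j, rfl, rfl⟩)

theorem lowerCentralSeries_le_basicSpan (c : Fin t → FormalCommutator k) (u : Fin k → G) (n : ℕ) :
    (⊤ : Subgroup G).lowerCentralSeries n ≤ basicSpan c u n :=
  le_sup_right

theorem basicSpan_le_lowerCentralSeries (c : Fin t → FormalCommutator k) (u : Fin k → G) (n : ℕ) :
    basicSpan c u n ≤ (⊤ : Subgroup G).lowerCentralSeries (n - 1) := by
  refine sup_le ((closure_le _).2 ?_) (Subgroup.lowerCentralSeries_antitone _ (by omega))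
  rintro _ ⟨j, rfl, rfl⟩
  exact FormalCommutator.eval_mem_lowerCentralSeries _ _

theorem basicSpan_succ_normal (c : Fin t → FormalCommutator k) (u : Fin k → G) (n : ℕ) :
    (basicSpan c u (n + 1)).Normal :=
  normal_of_lowerCentralSeries_le (lowerCentralSeries_le_basicSpan c u (n + 1))
    (basicSpan_le_lowerCentralSeries c u (n + 1))

/-- The elements commuting with `y` modulo `N` form a subgroup, so generators suffice. -/
theorem commutatorElement_mem_of_mem_basicSpan {N : Subgroup G} [N.Normal] {u : Fin k → G} {n : ℕ}
    {x y : G} (hx : x ∈ basicSpan c u n)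
    (h₁ : ∀ j, (c j).order = n → ⁅(c j).eval u, y⁆ ∈ N)
    (h₂ : ∀ z ∈ (⊤ : Subgroup G).lowerCentralSeries n, ⁅z, y⁆ ∈ N) : ⁅x, y⁆ ∈ N := by
  refine commutatorElement_mem_comm (mem_centralizerMod.1 ?_)
  refine (sup_le ((closure_le _).2 ?_) ?_ : basicSpan c u n ≤ _) hx
  · rintro _ ⟨j, hj, rfl⟩
    exact mem_centralizerMod.2 (commutatorElement_mem_comm (h₁ j hj))
  · exact fun z hz => mem_centralizerMod.2 (commutatorElement_mem_comm (h₂ z hz))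

/-- Modulo the next term of the lower central series, the commutator of two basic commutators is
a product of basic commutators of the same order. -/
theorem commutatorElement_eval_mem_basicSpan (hc : IsBasicCommutatorList k s c) (u : Fin k → G)
    (n : ℕ) (hn : n ≤ s) (i j : Fin t) (hij : (c i).order + (c j).order = n) :
    ⁅(c i).eval u, (c j).eval u⁆ ∈ basicSpan c u n := by
  induction n using Nat.strong_induction_on generalizing i j with
  | _ n ih =>
  -- For fixed order, a second induction treats pairs late in the list first: `d` says that both
  -- positions are at least t - d.
  suffices H : ∀ d : ℕ, ∀ i j : Fin t, t ≤ d + i → t ≤ d + j → (c i).order + (c j).order = n →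
      ⁅(c i).eval u, (c j).eval u⁆ ∈ basicSpan c u n from
    H t i j (by omega) (by omega) hij
  clear hij i j
  intro d
  induction d with
  | zero => intro i j hi; omega
  | succ d ihd =>
  suffices H : ∀ i j : Fin t, j < i → t ≤ d + 1 + j → (c i).order + (c j).order = n →
      ⁅(c i).eval u, (c j).eval u⁆ ∈ basicSpan c u n by
    intro i j hi hj hij
    rcases lt_trichotomy i j with h | rfl | h
    · exact commutatorElement_mem_comm (H j i h hi (by omega))
    · simp
    · exact H i j h hj hij
  intro i j hji hj hij
  have hi₀ := (c i).order_pos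
  have hj₀ := (c j).order_pos
  obtain ⟨n, rfl⟩ : ∃ m, n = m + 1 := ⟨n - 1, by omega⟩
  have hN := basicSpan_succ_normal c u n
  by_cases hb : ∀ a₁ a₂, c i = .comm a₁ a₂ → ∃ m, c m = a₂ ∧ m ≤ j
  · obtain ⟨m, hm⟩ := (hc.mem_iff (c i) (c j)).2 ⟨by simp only [FormalCommutator.order]; omega,
      i, j, rfl, rfl, hji, hb⟩
    have hmem := eval_mem_basicSpan c u m
    rwa [hm, FormalCommutator.order, hij, FormalCommutator.eval_comm,
      commutatorElement_inv_inv_mem_iff] at hmem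
  -- The pair is not basic: c_i = [c_p, c_q] with j < q < p. Jacobi trades [[p, q], j] for [[q, j],
  -- p] and [[j, p], q]. The inner commutators have smaller order than `n + 1`, so the outer
  -- induction expands them in members of order above that of c_j. These members, c_p and c_q all
  -- come after `j`, where the inner induction applies.
  push Not at hb
  obtain ⟨a₁, a₂, hi, hq⟩ := hb
  obtain ⟨-, p, q, rfl, rfl, hqp, -⟩ := (hc.mem_iff a₁ a₂).1 ⟨i, hi⟩
  have hjq := hq q rfl
  have hord : (c i).order = (c p).order + (c q).order := by rw [hi]; rfl
  have hp₀ := (c p).order_pos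
  have hq₀ := (c q).order_pos
  have hlow {a b : ℕ} {x y : G} (hx : x ∈ (⊤ : Subgroup G).lowerCentralSeries a)
      (hy : y ∈ (⊤ : Subgroup G).lowerCentralSeries b) (hab : n + 1 ≤ a + b + 1) :
      ⁅x, y⁆ ∈ basicSpan c u (n + 1) :=
    lowerCentralSeries_le_basicSpan c u _ (commutatorElement_mem_lowerCentralSeries hx hy hab)
  -- By the inner induction: elements of large order commute with the members after `j`.
  have hmix (m : Fin t) (hjm : j < m) (v : ℕ) (hv : v + (c m).order = n + 1)
      (hjv : (c j).order < v) (x : G) (hx : x ∈ basicSpan c u v) :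
      ⁅x, (c m).eval u⁆ ∈ basicSpan c u (n + 1) := by
    refine commutatorElement_mem_of_mem_basicSpan hx (fun l hl => ?_) fun z hz =>
      hlow hz ((c m).eval_mem_lowerCentralSeries u) (by have := (c m).order_pos; omega)
    have hjl : j < l := hc.lt_of_order_lt (by omega)
    exact ihd l m (by omega) (by omega) (by omega)
  have hpN := ((c p).eval_mem_lowerCentralSeries u)
  have hqN := ((c q).eval_mem_lowerCentralSeries u)
  have hjN := ((c j).eval_mem_lowerCentralSeries u)
  rw [hi, FormalCommutator.eval_comm]
  have h_qj : ⁅((c q).eval u)⁻¹, (c j).eval u⁆ ∈ basicSpan c u ((c q).order + (c j).order) := by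
    obtain ⟨m, hm⟩ : ∃ m, (c q).order + (c j).order = m + 1 := 
      Nat.exists_eq_add_one_of_ne_zero (by omega)
    have := ih ((c q).order + (c j).order) (by omega) (by omega) q j rfl
    have := basicSpan_succ_normal c u m
    rw [hm] at *
    rw [commutatorElement_mem_iff_commute, QuotientGroup.mk_inv, Commute.inv_left_iff,
      ← commutatorElement_mem_iff_commute]
    assumption
  have h_jp : ⁅(c j).eval u, ((c p).eval u)⁻¹⁆ ∈ basicSpan c u ((c j).order + (c p).order) := by
    obtain ⟨m, hm⟩ : ∃ m, (c j).order + (c p).order = m + 1 := 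
      Nat.exists_eq_add_one_of_ne_zero (by omega)
    have := ih ((c j).order + (c p).order) (by omega) (by omega) j p rfl
    have := basicSpan_succ_normal c u m
    rw [hm] at *
    rw [commutatorElement_mem_iff_commute, QuotientGroup.mk_inv, Commute.inv_right_iff,
      ← commutatorElement_mem_iff_commute]
    assumption
  have h_inv {x y : G} (h : ⁅x, y⁆ ∈ basicSpan c u (n + 1)) :
      ⁅x, y⁻¹⁆ ∈ basicSpan c u (n + 1) := by
    rw [commutatorElement_mem_iff_commute] at *
    exact h.inv_right
  have h_pq := commutatorElement_mem_lowerCentralSeries (inv_mem hpN) (inv_mem hqN) le_rfl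
  have h_qj' := basicSpan_le_lowerCentralSeries c u _ h_qj
  have h_jp' := basicSpan_le_lowerCentralSeries c u _ h_jp
  -- A commutator of two of the three pairwise commutators uses one of c_p, c_q, c_j twice, so it
  -- lies in the next term of the series.
  refine commutatorElement_mem_of_rotate (hlow h_pq h_qj' (by omega))
    (hlow h_qj' h_jp' (by omega)) (hlow h_jp' h_pq (by omega)) ?_ ?_
  · exact h_inv (hmix p (hjq.trans hqp) _ (by omega) (by omega) _ h_qj)
  · exact h_inv (hmix q hjq _ (by omega) (by omega) _ h_jp)

/-- Modulo the next term the commutator is bilinear, so by induction it suffices to bracket basic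
commutators of order `n` with letters. -/
theorem lowerCentralSeries_le_basicSpan_succ (hc : IsBasicCommutatorList k s c) {u : Fin k → G}
    (hu : closure (Set.range u) = ⊤) (n : ℕ) (hn : n < s) :
    (⊤ : Subgroup G).lowerCentralSeries n ≤ basicSpan c u (n + 1) := by
  induction n with
  | zero =>
    rw [Subgroup.lowerCentralSeries_zero, ← hu, closure_le]
    rintro _ ⟨i, rfl⟩
    obtain ⟨j, -, hj⟩ := hc.exists_letter i
    have := eval_mem_basicSpan c u j
    rwa [hj] at this
  | succ n ih =>
    have hN := basicSpan_succ_normal c u (n + 1)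
    rw [Subgroup.lowerCentralSeries_succ, commutator_le]
    intro x hx y _
    rw [← mem_centralizerMod]
    suffices H : closure (Set.range u) ≤ centralizerMod (basicSpan c u (n + 1 + 1)) x from
      H (hu ▸ mem_top y)
    rw [closure_le]
    rintro _ ⟨i, rfl⟩
    refine mem_centralizerMod.2
      (commutatorElement_mem_of_mem_basicSpan (ih (by omega) hx) (fun j hj => ?_) fun z hz => ?_)
    · obtain ⟨m, -, hm⟩ := hc.exists_letter i
      have := commutatorElement_eval_mem_basicSpan hc u _ (by omega) j m
        (by rw [hj, hm]; rfl : _ = n + 1 + 1)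
      rwa [hm] at this
    · exact lowerCentralSeries_le_basicSpan c u _
        (commutator_mem_commutator hz (mem_top _))

theorem lowerCentralSeries_le_closure_sup (hc : IsBasicCommutatorList k s c) {u : Fin k → G}
    (hu : closure (Set.range u) = ⊤) (n : ℕ) (hn : n ≤ s) :
    (⊤ : Subgroup G).lowerCentralSeries n ≤
      closure {x | ∃ j, n < (c j).order ∧ (c j).eval u = x} ⊔
        (⊤ : Subgroup G).lowerCentralSeries s := by
  induction hn using Nat.decreasingInduction with
  | self => exact le_sup_right
  | of_succ n hn ih =>
    refine (lowerCentralSeries_le_basicSpan_succ hc hu n hn).trans (sup_le ?_ (ih.trans ?_))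
    · refine le_sup_of_le_left (Subgroup.closure_mono ?_)
      rintro _ ⟨j, hj, rfl⟩
      exact ⟨j, by omega, rfl⟩
    · refine sup_le_sup_right (Subgroup.closure_mono ?_) _
      rintro _ ⟨j, hj, rfl⟩
      exact ⟨j, by omega, rfl⟩

end BasicSpan

theorem List.prod_ofFn_eq_mul_update {M : Type*} [Monoid M] {t : ℕ} (f : Fin t → M) (r : Fin t)
    (hf : ∀ j < r, f j = 1) :
    (List.ofFn f).prod = f r * (List.ofFn (Function.update f r 1)).prod := by
  induction t with
  | zero => exact r.elim0
  | succ t ih =>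
    rw [List.ofFn_succ, List.ofFn_succ, List.prod_cons, List.prod_cons]
    induction r using Fin.cases with
    | zero => simp
    | succ r =>
      have h₀ : f 0 = 1 := hf 0 (Fin.succ_pos r)
      have e : (fun i : Fin t => Function.update f r.succ 1 i.succ) =
          Function.update (fun i : Fin t => f i.succ) r 1 :=
        Function.update_comp_eq_of_injective f (Fin.succ_injective t) r 1
      rw [e, ih (fun i => f i.succ) r fun j hj => hf _ (Fin.succ_lt_succ_iff.2 hj)]
      simp [h₀, Function.update_of_ne (Fin.succ_ne_zero r).symm]

/-! ### Ordered products of powers -/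

section OrderedProd

variable {G H : Type*} [Group G] [Group H] {t : ℕ}

/-- The ordered product `x₁ ^ l₁ ⋯ x_t ^ l_t`. -/
def orderedProd (x : Fin t → G) (l : Fin t → ℤ) : G :=
  (List.ofFn fun j => x j ^ l j).prod

theorem orderedProd_zero (x : Fin t → G) : orderedProd x 0 = 1 := by
  refine List.prod_eq_one fun y hy => ?_
  obtain ⟨j, rfl⟩ := (List.mem_ofFn' _ _).1 hy
  simp

theorem orderedProd_eq_mul_update (x : Fin t → G) (l : Fin t → ℤ) (r : Fin t)
    (hl : ∀ j < r, l j = 0) :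
    orderedProd x l = x r ^ l r * orderedProd x (Function.update l r 0) := by
  rw [orderedProd, List.prod_ofFn_eq_mul_update _ r fun j hj => by rw [hl j hj, zpow_zero],
    orderedProd]
  congr 3
  ext j
  rcases eq_or_ne j r with rfl | h
  · simp
  · simp [h]

theorem zpow_mul_orderedProd (x : Fin t → G) (e : Fin t → ℤ) (r : Fin t) (a : ℤ)
    (he : ∀ j ≤ r, e j = 0) :
    x r ^ a * orderedProd x e = orderedProd x (Function.update e r a) := by
  rw [orderedProd_eq_mul_update x (Function.update e r a) r
    fun j hj => by rw [Function.update_of_ne hj.ne, he j hj.le], Function.update_self,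
    Function.update_idem, Function.update_eq_self_iff.2 (he r le_rfl).symm]

theorem orderedProd_single (x : Fin t → G) (r : Fin t) (a : ℤ) :
    orderedProd x (Pi.single r a) = x r ^ a := by
  rw [Pi.single, ← zpow_mul_orderedProd x 0 r a fun _ _ => rfl, orderedProd_zero, mul_one]

theorem mul_mul_orderedProd (x : Fin t → G) {e : Fin t → ℤ} {i j : Fin t} (hij : i < j)
    (he : ∀ m ≤ j, e m = 0) :
    x i * x j * orderedProd x e =
      orderedProd x (Function.update (Function.update e j 1) i 1) := by
  rw [mul_assoc, ← zpow_mul_orderedProd, zpow_one, ← zpow_mul_orderedProd x e j 1 he, zpow_one]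
  intro m hm
  rw [Function.update_of_ne (hm.trans_lt hij).ne, he m (hm.trans hij.le)]

theorem map_orderedProd (f : G →* H) (x : Fin t → G) (l : Fin t → ℤ) :
    f (orderedProd x l) = orderedProd (fun j => f (x j)) l := by
  simp [orderedProd, map_list_prod, List.map_ofFn, Function.comp_def]

theorem orderedProd_mem (x : Fin t → G) (l : Fin t → ℤ) (K : Subgroup G)
    (h : ∀ j, l j ≠ 0 → x j ∈ K) : orderedProd x l ∈ K := by
  refine list_prod_mem fun y hy => ?_
  obtain ⟨j, rfl⟩ := (List.mem_ofFn' _ _).1 hy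
  by_cases hj : l j = 0
  · simp [hj]
  · exact zpow_mem (h j hj) _

end OrderedProd

/-! ### Normal forms and universal commutation relations -/

section Spanning

variable {k s t : ℕ} {c : Fin t → FormalCommutator k} {G : Type*} [Group G]

/-- The subgroup generated by the values of the members of `c` from position `r` on, together with
the term of index `s` of the lower central series. -/
def tailSpan (s : ℕ) (c : Fin t → FormalCommutator k) (u : Fin k → G) (r : ℕ) : Subgroup G :=
  closure {x | ∃ j : Fin t, r ≤ j ∧ (c j).eval u = x} ⊔ (⊤ : Subgroup G).lowerCentralSeries s

/-- The tail lies between two consecutive terms of the lower central series, those at the order of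
c_r; members of equal order may thus be cut anywhere. -/
theorem tailSpan_succ_normal (hc : IsBasicCommutatorList k s c) (hs : 1 ≤ s) {u : Fin k → G}
    (hu : closure (Set.range u) = ⊤) (r : Fin t) : (tailSpan s c u (r + 1)).Normal := by
  have hr₀ := (c r).order_pos
  have hrs := hc.order_le hs r
  apply normal_of_lowerCentralSeries_le (n := (c r).order - 1)
  · refine (lowerCentralSeries_le_closure_sup hc hu _ (by omega)).trans
      (sup_le_sup_right (Subgroup.closure_mono ?_) _)
    rintro _ ⟨j, hj, rfl⟩
    exact ⟨j, hc.lt_of_order_lt (by omega), rfl⟩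
  · refine sup_le ((closure_le _).2 ?_) (Subgroup.lowerCentralSeries_antitone _ (by omega))
    rintro _ ⟨j, hj, rfl⟩
    have := hc.order_mono r j (Fin.le_def.2 (by omega))
    exact Subgroup.lowerCentralSeries_antitone _ (by omega)
      ((c j).eval_mem_lowerCentralSeries u)

/-- Normality of the shorter tail allows a power of c_r to be split off on the left, one position at
a time. -/
theorem exists_orderedProd_of_mem_tailSpan (hc : IsBasicCommutatorList k s c) (hs : 1 ≤ s)
    {u : Fin k → G} (hu : closure (Set.range u) = ⊤) (r : ℕ) (hr : r ≤ t) (g : G)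
    (hg : g ∈ tailSpan s c u r) :
    ∃ l : Fin t → ℤ, (∀ j : Fin t, j < r → l j = 0) ∧
      ∃ z ∈ (⊤ : Subgroup G).lowerCentralSeries s,
        g = orderedProd (fun j => (c j).eval u) l * z := by
  induction hr using Nat.decreasingInduction generalizing g with
  | self =>
    refine ⟨0, fun _ _ => rfl, g, ?_, by rw [orderedProd_zero, one_mul]⟩
    refine (sup_le ((closure_le _).2 ?_) le_rfl :
      tailSpan s c u t ≤ (⊤ : Subgroup G).lowerCentralSeries s) hg
    rintro _ ⟨j, hj, rfl⟩
    exact absurd j.2 hj.not_gt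
  | of_succ r hr ih =>
    have hN := tailSpan_succ_normal hc hs hu ⟨r, hr⟩
    have hle : tailSpan s c u r ≤ zpowers ((c ⟨r, hr⟩).eval u) ⊔ tailSpan s c u (r + 1) := by
      refine sup_le ((closure_le _).2 ?_) (le_sup_of_le_right le_sup_right)
      rintro _ ⟨j, hj, rfl⟩
      rcases hj.eq_or_lt with rfl | h
      · exact mem_sup_left (mem_zpowers _)
      · exact mem_sup_right (mem_sup_left (subset_closure ⟨j, h, rfl⟩))
    obtain ⟨_, ⟨a, rfl⟩, h, hh, rfl⟩ := (mem_sup_of_normal_right (t := tailSpan s c u (r + 1))).1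
      (hle hg)
    obtain ⟨l, hl, z, hz, rfl⟩ := ih h hh
    refine ⟨Function.update l ⟨r, hr⟩ a, fun j hj => ?_, z, hz, ?_⟩
    · rw [Function.update_of_ne (Fin.ne_of_lt (Fin.lt_def.2 hj)), hl j (by omega)]
    · rw [← mul_assoc]
      congr 1
      exact zpow_mul_orderedProd (fun j => (c j).eval u) l ⟨r, hr⟩ a fun j hj => hl j (Nat.lt_succ_of_le hj)

/-- Every element of the lower central series is an ordered product of basic commutators of large
order, modulo a later term of the series. -/
theorem exists_orderedProd_of_mem_lowerCentralSeries (hc : IsBasicCommutatorList k s c)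
    (hs : 1 ≤ s) {u : Fin k → G} (hu : closure (Set.range u) = ⊤) (n : ℕ) (hn : n ≤ s) (g : G)
    (hg : g ∈ (⊤ : Subgroup G).lowerCentralSeries n) :
    ∃ l : Fin t → ℤ, (∀ j, l j ≠ 0 → n < (c j).order) ∧
      ∃ z ∈ (⊤ : Subgroup G).lowerCentralSeries s,
        g = orderedProd (fun j => (c j).eval u) l * z := by
  -- Orders are non-decreasing, so the members of order above `n` form a tail of the list.
  obtain ⟨r, hrt, hr⟩ : ∃ r ≤ t, ∀ j : Fin t, r ≤ j ↔ n < (c j).order := by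
    classical
    have hex : ∃ r : ℕ, ∀ j : Fin t, r ≤ j → n < (c j).order := ⟨t, fun j hj => absurd j.2 hj.not_gt⟩
    refine ⟨Nat.find hex, Nat.find_min' hex fun j hj => absurd j.2 hj.not_gt,
      fun j => ⟨Nat.find_spec hex j, fun hj => Nat.find_min' hex fun i hi => ?_⟩⟩
    exact hj.trans_le (hc.order_mono j i (Fin.le_def.2 hi))
  obtain ⟨l, hl, h⟩ := exists_orderedProd_of_mem_tailSpan hc hs hu r hrt g (by
    simpa only [tailSpan, hr] using lowerCentralSeries_le_closure_sup hc hu n hn hg)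
  exact ⟨l, fun j hj => (hr j).1 (le_of_not_gt fun h => hj (hl j h)), h⟩

/-- Commutators of basic commutators with letters are ordered products of later basic commutators,
with exponents that depend on the list only. -/
theorem exists_universal_exponents (hc : IsBasicCommutatorList k s c) (hs : 1 ≤ s) (j : Fin t)
    (i : Fin k) :
    ∃ e : Fin t → ℤ, (∀ m, e m ≠ 0 → (c j).order < (c m).order) ∧
      ∀ (G : Type*) [Group G] (u : Fin k → G),
        (closure (Set.range u)).lowerCentralSeries s = ⊥ →
          (c j).eval u * u i = u i * (c j).eval u * orderedProd (fun m => (c m).eval u) e := by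
  -- Exponents are chosen once, in the free group; the error term `z` dies in every group where `u`
  -- generates a subgroup of class at most `s`.
  let x : FreeGroup (Fin k) := (c j).eval FreeGroup.of
  have hmem : ⁅x⁻¹, (FreeGroup.of i)⁻¹⁆ ∈
      (⊤ : Subgroup (FreeGroup (Fin k))).lowerCentralSeries (c j).order := by
    refine commutatorElement_mem_lowerCentralSeries (q := 0)
      (inv_mem ((c j).eval_mem_lowerCentralSeries _)) (mem_top _) ?_
    have := (c j).order_pos
    omega
  obtain ⟨e, he, z, hz, hprod⟩ := exists_orderedProd_of_mem_lowerCentralSeries hc hs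
    (FreeGroup.closure_range_of (Fin k)) _ (hc.order_le hs j) _ hmem
  refine ⟨e, he, fun G _ u hu => ?_⟩
  have hlift (a : FormalCommutator k) :
      FreeGroup.lift u (a.eval FreeGroup.of) = a.eval u := by
    simp [FormalCommutator.map_eval]
  have hz' : FreeGroup.lift u z = 1 := by
    have := mem_map_of_mem (FreeGroup.lift u) hz
    rwa [map_lowerCentralSeries, ← MonoidHom.range_eq_map, FreeGroup.range_lift_eq_closure, hu,
      mem_bot] at this
  have := congrArg (FreeGroup.lift u) hprod
  rw [map_mul, hz', mul_one, map_orderedProd, map_commutatorElement, map_inv, map_inv, hlift,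
    FreeGroup.lift_apply_of] at this
  simp only [hlift] at this
  rw [← this, commutatorElement_def]
  group

end Spanning

/-! ### Freiman homomorphisms on boxes of ordered products -/

section Freiman

variable {G H : Type*} [Group G] [Group H]

theorem IsFreimanHom.map_one {A : Set G} {φ : G → H} (h : IsFreimanHom 3 A φ) (h₁ : 1 ∈ A) :
    φ 1 = 1 := by
  have := h (fun _ => 1) ![1, 0, 0] (fun _ => h₁) (by simp [Fin.forall_fin_succ]) (by simp)
  simpa [List.ofFn_succ] using this

/-- The relation a · b · (ab)⁻¹ = 1 is what requires three factors. -/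
theorem IsFreimanHom.map_mul {A : Set G} {φ : G → H} (h : IsFreimanHom 3 A φ) {a b : G}
    (ha : a ∈ A) (hb : b ∈ A) (hab : a * b ∈ A) : φ (a * b) = φ a * φ b := by
  have := h ![a, b, a * b] ![1, 1, -1] (by simp [Fin.forall_fin_succ, *])
    (by simp [Fin.forall_fin_succ]) (by simp [List.ofFn_succ])
  simp only [List.ofFn_succ, List.ofFn_zero, List.prod_cons, List.prod_nil] at this
  simp [← mul_assoc] at this
  exact (mul_inv_eq_one.1 this).symm

/-- The ordered products of `x` with exponents bounded by `N`. -/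
def orderedBox {t : ℕ} (x : Fin t → G) (N : Fin t → ℤ) : Set G :=
  {g | ∃ l : Fin t → ℤ, (∀ j, |l j| ≤ N j) ∧ g = orderedProd x l}

variable {t : ℕ} {x : Fin t → G} {N : Fin t → ℤ}

theorem abs_update_le {l : Fin t → ℤ} (hl : ∀ j, |l j| ≤ N j) (r : Fin t) {a : ℤ}
    (ha : |a| ≤ N r) (j : Fin t) : |Function.update l r a j| ≤ N j := by
  rcases eq_or_ne j r with rfl | h
  · rwa [Function.update_self]
  · rw [Function.update_of_ne h]
    exact hl j

theorem zpow_mem_orderedBox (hN : ∀ j, 0 ≤ N j) (r : Fin t) {a : ℤ} (ha : |a| ≤ N r) :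
    x r ^ a ∈ orderedBox x N :=
  ⟨Pi.single r a, abs_update_le (fun j => by simpa using hN j) r ha,
    (orderedProd_single x r a).symm⟩

variable {φ : G → H}

theorem IsFreimanHom.map_zpow (h : IsFreimanHom 3 (orderedBox x N) φ) (hN : ∀ j, 1 ≤ N j)
    (r : Fin t) {a : ℤ} (ha : |a| ≤ N r) : φ (x r ^ a) = φ (x r) ^ a := by
  have hN₀ (j) : 0 ≤ N j := zero_le_one.trans (hN j)
  have h₁ : φ 1 = 1 := h.map_one <| by
    simpa using zpow_mem_orderedBox (x := x) hN₀ r (a := 0) (by simpa using hN₀ r)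
  have hmem {b : ℤ} (hb : |b| ≤ N r) : x r ^ b ∈ orderedBox x N := zpow_mem_orderedBox hN₀ r hb
  have hx : x r ∈ orderedBox x N := by simpa using hmem (b := 1) (by simpa using hN r)
  have hnat (n : ℕ) (hn : (n : ℤ) ≤ N r) : φ (x r ^ n) = φ (x r) ^ n := by
    have hpow {m : ℕ} (hm : (m : ℤ) ≤ N r) : x r ^ m ∈ orderedBox x N := by
      rw [← zpow_natCast]
      exact hmem (by rwa [Nat.abs_cast])
    induction n with
    | zero => simpa using h₁
    | succ n ih =>
      have hn' : (n : ℤ) ≤ N r := by push_cast at hn; omega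
      have hp := hpow hn
      rw [pow_succ] at hp ⊢
      rw [h.map_mul (hpow hn') hx hp, ih hn', pow_succ]
  rcases Int.eq_nat_or_neg a with ⟨n, rfl | rfl⟩
  · rw [Nat.abs_cast] at ha
    simpa using hnat n ha
  · have hn := hmem ha
    have hn' := hmem ((abs_neg _).symm.trans_le ha)
    rw [abs_neg, Nat.abs_cast] at ha
    have := h.map_mul hn' hn (by simpa using hmem (b := 0) (by simpa using hN₀ r))
    rw [← zpow_add, add_neg_cancel, zpow_zero, h₁, zpow_natCast, hnat n ha] at this
    rw [zpow_neg (φ (x r)), zpow_natCast]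
    exact eq_inv_of_mul_eq_one_right this.symm

/-- A Freiman homomorphism on a box of ordered products respects the ordered products. -/
theorem IsFreimanHom.map_orderedProd (h : IsFreimanHom 3 (orderedBox x N) φ) (hN : ∀ j, 1 ≤ N j)
    (l : Fin t → ℤ) (hl : ∀ j, |l j| ≤ N j) :
    φ (orderedProd x l) = orderedProd (fun j => φ (x j)) l := by
  have hN₀ (j) : 0 ≤ N j := zero_le_one.trans (hN j)
  -- Splitting off the leading power leaves a shorter product still in the box, so `map_mul` applies
  -- at each stage.
  suffices H : ∀ r ≤ t, ∀ l : Fin t → ℤ, (∀ j, |l j| ≤ N j) → (∀ j : Fin t, j < r → l j = 0) →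
      φ (orderedProd x l) = orderedProd (fun j => φ (x j)) l from
    H 0 (Nat.zero_le t) l hl fun j hj => absurd hj (Nat.not_lt_zero _)
  clear hl l
  intro r hr
  induction hr using Nat.decreasingInduction with
  | self =>
    intro l _ hl₀
    obtain rfl : l = 0 := funext fun j => hl₀ j j.2
    rw [orderedProd_zero, orderedProd_zero]
    exact h.map_one ⟨0, fun j => by simpa using hN₀ j, (orderedProd_zero x).symm⟩
  | of_succ r hr ih =>
    intro l hl hl₀
    have hz (j) : |Function.update l ⟨r, hr⟩ 0 j| ≤ N j :=
      abs_update_le hl _ (by simpa using hN₀ _) j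
    have hmem : orderedProd x l ∈ orderedBox x N := ⟨l, hl, rfl⟩
    rw [orderedProd_eq_mul_update x l ⟨r, hr⟩ fun j hj => hl₀ j (Fin.lt_def.1 hj)] at hmem ⊢
    rw [orderedProd_eq_mul_update (fun j => φ (x j)) l ⟨r, hr⟩ fun j hj => hl₀ j (Fin.lt_def.1 hj),
      h.map_mul (zpow_mem_orderedBox hN₀ _ (hl _)) ⟨_, hz, rfl⟩ hmem, h.map_zpow hN _ (hl _),
      ih _ hz fun j hj => ?_]
    rcases (Nat.lt_succ_iff_lt_or_eq.1 hj) with hj | hj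
    · rw [Function.update_of_ne (Fin.ne_of_lt (Fin.lt_def.2 hj)), hl₀ j hj]
    · rw [Fin.ext (b := ⟨r, hr⟩) hj, Function.update_self]

/-- A Freiman homomorphism on a box of ordered products respects the relations
`x_j x_i = x_i x_j ∏ x_m ^ e_m` in which only `m > j > i` occur. -/
theorem IsFreimanHom.map_swap (h : IsFreimanHom 3 (orderedBox x N) φ) (hN : ∀ j, 1 ≤ N j)
    {i j : Fin t} (hij : i < j) {e : Fin t → ℤ} (he : ∀ m, |e m| ≤ N m)
    (hej : ∀ m, e m ≠ 0 → j < m) (hx : x j * x i = x i * x j * orderedProd x e) :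
    φ (x j) * φ (x i) = φ (x i) * φ (x j) * orderedProd (fun m => φ (x m)) e := by
  have hN₀ (j) : 0 ≤ N j := zero_le_one.trans (hN j)
  have hgen (m) : x m ∈ orderedBox x N := by
    simpa using zpow_mem_orderedBox (x := x) hN₀ m (a := 1) (by simpa using hN m)
  have he₀ (m) (hm : m ≤ j) : e m = 0 := by_contra fun h => (hej m h).not_ge hm
  -- As `e` lives beyond j > i, the right-hand side is already ordered and lies in the box; hence so
  -- does x_j x_i.
  let l := Function.update (Function.update e j 1) i 1
  have hl (m) : |l m| ≤ N m :=
    abs_update_le (abs_update_le he j (by simpa using hN j)) i (by simpa using hN i) m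
  rw [mul_mul_orderedProd x hij he₀] at hx
  rw [← h.map_mul (hgen j) (hgen i) (hx ▸ ⟨l, hl, rfl⟩), hx, h.map_orderedProd hN l hl,
    mul_mul_orderedProd (fun m => φ (x m)) hij he₀]

end Freiman

/-! ### Nilpotency from the commutation relations -/

section Nilpotency

variable {k s t : ℕ} {c : Fin t → FormalCommutator k} {G : Type*} [Group G]

/-- Let K_n be generated by the basic commutators of order above `n`. If K_{n+1} is normal,
generators give [K_n, G] ≤ K_{n+1} ≤ K_n, so K_n is normal too. Starting from K_s = 1 and
descending, this makes the K_n a central series that dominates the lower one. -/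
theorem lowerCentralSeries_top_eq_bot_of_commutator_mem (hc : IsBasicCommutatorList k s c)
    (hs : 1 ≤ s) {u : Fin k → G} (hu : closure (Set.range u) = ⊤)
    (h : ∀ j i, ⁅((c j).eval u)⁻¹, (u i)⁻¹⁆ ∈
      closure {x | ∃ m, (c j).order < (c m).order ∧ (c m).eval u = x}) :
    (⊤ : Subgroup G).lowerCentralSeries s = ⊥ := by
  let K (n : ℕ) : Subgroup G := closure {x | ∃ m, n < (c m).order ∧ (c m).eval u = x}
  have hK : Antitone K := by
    refine fun a b hab => Subgroup.closure_mono ?_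
    rintro _ ⟨m, hm, rfl⟩
    exact ⟨m, hab.trans_lt hm, rfl⟩
  have hbot : K s = ⊥ := by
    refine closure_eq_bot_iff.2 ?_
    rintro _ ⟨m, hm, rfl⟩
    exact absurd (hc.order_le hs m) hm.not_ge
  have hstep (n : ℕ) (hN : (K (n + 1)).Normal) : ⁅K n, ⊤⁆ ≤ K (n + 1) := by
    rw [commutator_le]
    intro x hx y _
    rw [← mem_centralizerMod]
    suffices H : closure (Set.range u) ≤ centralizerMod (K (n + 1)) x from H (hu ▸ mem_top y)
    rw [closure_le]
    rintro _ ⟨i, rfl⟩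
    refine mem_centralizerMod.2 (commutatorElement_mem_comm (mem_centralizerMod.1 ?_))
    refine ((closure_le _).2 ?_ : K n ≤ _) hx
    rintro _ ⟨j, hj, rfl⟩
    exact mem_centralizerMod.2 (commutatorElement_mem_comm
      (commutatorElement_inv_inv_mem_iff.1 (hK hj (h j i))))
  have hnormal (n : ℕ) (hn : n ≤ s) : (K n).Normal := by
    induction hn using Nat.decreasingInduction with
    | self => rw [hbot]; infer_instance
    | of_succ n _ ih =>
      exact commutator_top_right_le_iff.1 ((hstep n ih).trans (hK n.le_succ))
  have hle (n : ℕ) (hn : n ≤ s) : (⊤ : Subgroup G).lowerCentralSeries n ≤ K n := by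
    induction n with
    | zero =>
      rw [Subgroup.lowerCentralSeries_zero, ← hu, closure_le]
      rintro _ ⟨i, rfl⟩
      obtain ⟨j, -, hj⟩ := hc.exists_letter i
      exact subset_closure ⟨j, (c j).order_pos, by rw [hj]; rfl⟩
    | succ n ih =>
      exact (commutator_mono (ih (by omega)) le_rfl).trans (hstep n (hnormal _ hn))
  exact le_bot_iff.1 (hbot ▸ hle s le_rfl)

/-- If the commutators of the basic commutators with the letters are products of basic
commutators of larger order, then the letters generate an `s`-step nilpotent group. -/
theorem lowerCentralSeries_closure_eq_bot (hc : IsBasicCommutatorList k s c) (hs : 1 ≤ s)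
    {v : Fin k → G} (e : Fin t → Fin k → Fin t → ℤ)
    (he : ∀ j i m, e j i m ≠ 0 → (c j).order < (c m).order)
    (hv : ∀ j i, i.val < j.val → (c j).eval v * v i =
      v i * (c j).eval v * orderedProd (fun m => (c m).eval v) (e j i)) :
    (closure (Set.range v)).lowerCentralSeries s = ⊥ := by
  let W := closure (Set.range v)
  let w (i : Fin k) : W := ⟨v i, subset_closure ⟨i, rfl⟩⟩
  have hw (a : FormalCommutator k) : ((a.eval w : W) : G) = a.eval v := a.map_eval W.subtype w
  have hwW : closure (Set.range w) = ⊤ := by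
    have := closure_closure_coe_preimage (k := Set.range v)
    convert this using 2
    ext ⟨x, hx⟩
    simp [w, Subtype.ext_iff]
  have hrel (j : Fin t) (i : Fin k) (hij : i.val < j.val) :
      (c j).eval w * w i = w i * (c j).eval w * orderedProd (fun m => (c m).eval w) (e j i) := by
    apply W.subtype_injective
    simp only [map_mul, map_orderedProd, subtype_apply, hw]
    exact hv j i hij
  have hmem (j : Fin t) (i : Fin k) (hij : i.val < j.val) :
      ⁅((c j).eval w)⁻¹, (w i)⁻¹⁆ ∈
        closure {x | ∃ m, (c j).order < (c m).order ∧ (c m).eval w = x} := by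
    have : ⁅((c j).eval w)⁻¹, (w i)⁻¹⁆ = orderedProd (fun m => (c m).eval w) (e j i) := by
      rw [commutatorElement_def, inv_inv, inv_inv, mul_assoc, hrel j i hij]
      group
    rw [this]
    exact orderedProd_mem _ _ _ fun m hm => subset_closure ⟨m, he j i m hm, rfl⟩
  rw [← top_subtype_lowerCentralSeries, lowerCentralSeries_top_eq_bot_of_commutator_mem hc hs hwW,
    Subgroup.map_bot]
  intro j i
  rcases lt_or_ge i.val j.val with hij | hji
  · exact hmem j i hij
  -- Here c_j is itself a letter, not after u_i; the commutator is trivial or is the inverse of one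
  -- already treated.
  obtain ⟨p, hp, hpj⟩ := hc.exists_letter ⟨j, hji.trans_lt i.2⟩
  obtain rfl : p = j := Fin.ext hp
  obtain ⟨q, hq, hqi⟩ := hc.exists_letter i
  have hqw : (c q).eval w = w i := by rw [hqi]; rfl
  have hpw : (c p).eval w = w ⟨p, hji.trans_lt i.2⟩ := by rw [hpj]; rfl
  rcases hji.eq_or_lt with hij | hij
  · rw [hpw, Fin.ext (a := ⟨p.val, hji.trans_lt i.2⟩) (b := i) hij, commutatorElement_self]
    exact one_mem _
  · have := commutatorElement_mem_comm (hmem q ⟨p, hji.trans_lt i.2⟩ (by simpa [hq] using hij))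
    rw [hqw, hqi] at this
    rw [hpw, hpj]
    exact this

end Nilpotency

/-! ### The image of a progression -/

section Image

variable {k s t : ℕ} {c : Fin t → FormalCommutator k} {G H : Type*} [Group G] [Group H]

/-- Every weight vector is nonzero, so a bound on the sides makes every exponent range large enough
for the universal exponents. -/
theorem le_sideLength (L : Fin k → ℕ) {C : ℕ} (hC : 1 ≤ C) (hL : ∀ i, C ≤ L i)
    (a : FormalCommutator k) : C ≤ ∏ i, L i ^ a.weight i := by
  obtain ⟨i, hi⟩ := a.exists_weight_pos
  calc C ≤ L i ^ 1 := (hL i).trans_eq (pow_one _).symm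
    _ ≤ L i ^ a.weight i := Nat.pow_le_pow_right (hC.trans (hL i)) hi
    _ ≤ ∏ i, L i ^ a.weight i :=
      Finset.single_le_prod' (f := fun i => L i ^ a.weight i)
        (fun i _ => Nat.one_le_pow _ _ (hC.trans (hL i))) (Finset.mem_univ i)

/-- For c_j = [c_p, c_q] the relation c_p c_q = c_q c_p c_j has the shape required by `map_swap`,
since q < p < j. Transporting it determines φ at the value of c_j. -/
theorem IsFreimanHom.map_eval (hc : IsBasicCommutatorList k s c) {u : Fin k → G}
    {N : Fin t → ℤ} (hN : ∀ j, 1 ≤ N j) {φ : G → H}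
    (hφ : IsFreimanHom 3 (orderedBox (fun j => (c j).eval u) N) φ) (j : Fin t) :
    φ ((c j).eval u) = (c j).eval (fun i => φ (u i)) := by
  induction j using WellFoundedLT.induction with
  | _ j ih =>
  rcases hj : c j with i | ⟨a, b⟩
  · rfl
  obtain ⟨-, p, q, rfl, rfl, hqp, -⟩ := (hc.mem_iff a b).1 ⟨j, hj⟩
  have hpj : p < j := hc.lt_of_order_lt (by
    rw [hj]
    exact Nat.lt_add_of_pos_right (c q).order_pos)
  have H := hφ.map_swap hN hqp (e := Pi.single j 1)
    (abs_update_le (fun m => by simpa using zero_le_one.trans (hN m)) j (by simpa using hN j))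
    (fun m hm => by
      rcases eq_or_ne m j with rfl | h
      · exact hpj
      · exact absurd (Pi.single_eq_of_ne h 1) hm)
    (by
      rw [orderedProd_single, zpow_one, hj, FormalCommutator.eval]
      group)
  rw [orderedProd_single, zpow_one, ih p hpj, ih q (hqp.trans hpj), hj] at H
  have H' := eq_inv_mul_of_mul_eq H.symm
  rw [H', FormalCommutator.eval]
  group

theorem IsFreimanHom.isNilpotentProgression_image (hc : IsBasicCommutatorList k s c) (hs : 1 ≤ s)
    {u : Fin k → G} {L : Fin k → ℕ} {C : ℕ} (hC : 1 ≤ C) (hL : ∀ i, C ≤ L i)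
    (e : Fin t → Fin k → Fin t → ℤ) (he : ∀ j i m, e j i m ≠ 0 → (c j).order < (c m).order)
    (heC : ∀ j i m, |e j i m| ≤ C)
    (hu : ∀ j i, (c j).eval u * u i =
      u i * (c j).eval u * orderedProd (fun m => (c m).eval u) (e j i))
    {φ : G → H} (hφ : IsFreimanHom 3 (nilpotentProgression c u L) φ) :
    IsNilpotentProgression s c L (φ '' nilpotentProgression c u L) := by
  let N (j : Fin t) : ℤ := ((∏ i, L i ^ (c j).weight i : ℕ) : ℤ)
  have hCN (j) : (C : ℤ) ≤ N j := Int.ofNat_le.2 (le_sideLength L hC hL (c j))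
  have hN (j) : 1 ≤ N j := (Int.ofNat_le.2 hC).trans (hCN j)
  have hφ' : IsFreimanHom 3 (orderedBox (fun j => (c j).eval u) N) φ := hφ
  have hev := hφ'.map_eval hc hN
  refine ⟨fun i => hC.trans (hL i), fun i => φ (u i), ?_, ?_⟩
  · refine lowerCentralSeries_closure_eq_bot hc hs e he fun j i hij => ?_
    obtain ⟨p, hp, hpi⟩ := hc.exists_letter i
    have hpu : (c p).eval u = u i := by rw [hpi]; rfl
    have H := hφ'.map_swap hN (i := p) (j := j) (Fin.lt_def.2 (hp.trans_lt hij))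
      (e := e j i) (fun m => (heC j i m).trans (hCN m))
      (fun m hm => hc.lt_of_order_lt (he j i m hm)) (by rw [hpu]; exact hu j i)
    simp only [hev] at H
    rw [hpi] at H
    exact H
  · have hmap (l : Fin t → ℤ) (hl : ∀ j, |l j| ≤ N j) :
        φ (orderedProd (fun j => (c j).eval u) l) =
          orderedProd (fun j => (c j).eval fun i => φ (u i)) l := by
      simp only [hφ'.map_orderedProd hN l hl, hev]
    ext y
    constructor
    · rintro ⟨_, ⟨l, hl, rfl⟩, rfl⟩
      exact ⟨l, hl, hmap l hl⟩
    · rintro ⟨l, hl, rfl⟩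
      exact ⟨_, ⟨l, hl, rfl⟩, hmap l hl⟩

end Image

/-! ### The uniform constant and the conclusion -/

theorem finite_isBasicCommutatorList (k s : ℕ) (hs : 1 ≤ s) :
    {p : Σ t, Fin t → FormalCommutator k | IsBasicCommutatorList k s p.2}.Finite := by
  let T := {a : FormalCommutator k | a.order ≤ s}
  have : Finite T := FormalCommutator.finite_order_le s
  refine (Set.finite_range fun q : Σ t : Fin (Nat.card T + 1), Fin t → T =>
    (⟨q.1, fun j => q.2 j⟩ : Σ t, Fin t → FormalCommutator k)).subset ?_
  rintro ⟨t, c⟩ hc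
  let c' (j : Fin t) : T := ⟨c j, IsBasicCommutatorList.order_le hc hs j⟩
  have hc' : Function.Injective c' := fun i j h => hc.injective (congrArg Subtype.val h)
  have ht : t ≤ Nat.card T := by simpa using Nat.card_le_card_of_injective c' hc'
  exact ⟨⟨⟨t, Nat.lt_succ_of_le ht⟩, c'⟩, rfl⟩

open Filter in
theorem propositionA1 (k s : ℕ) (hs : 1 ≤ s) :
    ∃ C : ℕ, 1 ≤ C ∧
      ∀ (t : ℕ) (c : Fin t → FormalCommutator k), IsBasicCommutatorList k s c →
      ∀ (G : Type*) [Group G] (H : Type*) [Group H] (A : Set G) (L : Fin k → ℕ),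
        IsNilpotentProgression s c L A → (∀ i, C ≤ L i) →
        ∀ (B : Set H) (φ : G → H), IsFreimanHom 3 A φ → φ '' A = B →
          ∃ L' : Fin k → ℕ, IsNilpotentProgression s c L' B := by
  choose! e he hrel using fun (p : Σ t, Fin t → FormalCommutator k)
    (hp : IsBasicCommutatorList k s p.2) => exists_universal_exponents hp hs
  -- Finiteness of the set of lists makes C independent of the list.
  have hbound : ∀ᶠ C : ℕ in atTop, ∀ p ∈ {p : Σ t, Fin t → FormalCommutator k |
      IsBasicCommutatorList k s p.2}, ∀ j i m, |e p j i m| ≤ C := by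
    refine (eventually_all_finite (finite_isBasicCommutatorList k s hs)).2 fun p _ => ?_
    simp only [eventually_all]
    intro j i m
    filter_upwards [eventually_ge_atTop (e p j i m).natAbs] with C hC
    rw [Int.abs_eq_natAbs]
    exact Int.ofNat_le.2 hC
  obtain ⟨C, hC, hC₁⟩ := (hbound.and (eventually_ge_atTop 1)).exists
  refine ⟨C, hC₁, fun t c hc G _ H _ A L hA hL B φ hφ hB => ⟨L, ?_⟩⟩
  obtain ⟨-, u, hu, rfl⟩ := hA
  rw [← hB]
  exact hφ.isNilpotentProgression_image hc hs hC₁ hL (e ⟨t, c⟩) (he ⟨t, c⟩ hc) (hC ⟨t, c⟩ hc)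
    fun j i => hrel ⟨t, c⟩ hc j i G u hu
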